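/- Let $A\subset\mathbb{R}^2$ be a bounded open set. Let $H^1(A)$ be the space of $u\in L^2(A)$ with weak gradient $\nabla u\in L^2(A)^2$, normed by $\|u\|_{H^1}^2=\|u\|_{L^2}^2+\|\nabla u\|_{L^2}^2$, let $H^1_0(A)$ be the closure of $C_c^\infty(A)$ in $H^1(A)$, and let $Y_0(A)=H^1_0(A)\otimes\mathrm{Sym}(2)$ be the space of symmetric $2\times2$ tensor fields with components in $H^1_0(A)$, with the norm $\|\sigma\|_Y^2=\|\sigma\|_{L^2}^2+\|\mathrm{D}\sigma\|_{L^2}^2=\sum_{i,j}\|\sigma_{ij}\|_{H^1}^2$. Write $(\operatorname{Div}\sigma)_i=\sum_j\partial_j\sigma_{ij}$ and $\operatorname{tr}\sigma=\sum_i\sigma_{ii}$. Let $\nu\in[0,\tfrac12]$, $\psi>0$, and let $\chi=\frac1{1+\nu}$ (plane stress) or $\chi=1-\nu$ (plane strain). Consider on $Y_0(A)$ the form $$a(\tau,\sigma)=\int_A \psi\,\langle\operatorname{Div}\tau,\operatorname{Div}\sigma\rangle+\chi\,\langle\nabla\operatorname{tr}\tau,\nabla\operatorname{tr}\sigma\rangle\,\mathrm{d}A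 .$$ Then there are constants $\alpha=\alpha(\psi,\chi)$ and $\beta=\beta(\psi,\chi)>0$ (for the given domain $A$) such that $$|a(\tau,\sigma)|\le\alpha\,\|\tau\|_Y\|\sigma\|_Y\quad\text{and}\quad a(\sigma,\sigma)\ge\beta\,\|\sigma\|_Y^2\qquad\text{for all }\tau,\sigma\in Y_0(A),$$ that is, $a$ is continuous and coercive. Moreover, for every continuous linear functional $l$ on $Y_0(A)$ there is a unique $\sigma\in Y_0(A)$ with $$a(\tau,\sigma)=l(\tau)\qquad\text{for all }\tau\in Y_0(A),$$ and it satisfies the stability estimate $\|\sigma\|_Y\le\frac1\beta\|l\|_{Y'}$, where $\|\cdot\|_{Y'}$ is the dual norm with respect to $Y_0(A)$. In particular, for every body force $f\in H^1(A)^2$ the load $$l(\tau)=\int_A\psi\,\langle\tau,\operatorname{sym}\mathrm{D}f\rangle+(\operatorname{tr}\tau)(\operatorname{div}f)\,\mathrm{d}A,\qquad \operatorname{sym}\mathrm{D}f=\tfrac12\big(\mathrm{D}f+(\mathrm{D}f)^T\big),$$ is a continuous linear functional on $Y_0(A)$, so the planar stress problem $a(\tau,\sigma)=l(\tau)$ for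 all $\tau\in Y_0(A)$ has a unique solution $\sigma\in Y_0(A)$, and $\|\sigma\|_Y\le\frac1\beta\|l\|_{Y'}$. -/

import Mathlib

open MeasureTheory
open scoped ContDiff

noncomputable section

namespace PlanarStress

/-- The Euclidean plane. -/
abbrev Plane : Type := EuclideanSpace ℝ (Fin 2)

/-- The Lebesgue space `L²(A)` of a planar set `A`. -/
abbrev L2 (A : Set Plane) : Type := Lp ℝ 2 (volume.restrict A)

/-- Smooth functions with compact support contained in `A`. -/
structure IsTest (A : Set Plane) (φ : Plane → ℝ) : Prop where
  smooth : ContDiff ℝ ∞ φ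
  compact : HasCompactSupport φ
  supp : tsupport φ ⊆ A

/-- The classical partial derivative in the `i`-th coordinate direction. -/
def partialDeriv (i : Fin 2) (φ : Plane → ℝ) (x : Plane) : ℝ :=
  fderiv ℝ φ x (EuclideanSpace.single i 1)

/-- `g` is the weak partial derivative `∂ᵢ u` in `A`. -/
def IsWeakPartial (A : Set Plane) (i : Fin 2) (u g : L2 A) : Prop :=
  ∀ φ : Plane → ℝ, IsTest A φ →
    ∫ x in A, u x * partialDeriv i φ x = -∫ x in A, g x * φ x

theorem IsTest.memLp {A : Set Plane} {φ : Plane → ℝ} (h : IsTest A φ) :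
    MemLp φ 2 (volume.restrict A) :=
  (h.smooth.continuous.memLp_of_hasCompactSupport h.compact).restrict A

theorem IsTest.memLp_partialDeriv {A : Set Plane} {φ : Plane → ℝ} (h : IsTest A φ)
    (i : Fin 2) : MemLp (partialDeriv i φ) 2 (volume.restrict A) := by
  have hc : Continuous (partialDeriv i φ) :=
    (h.smooth.continuous_fderiv (by simp)).clm_apply continuous_const
  have hs : HasCompactSupport (partialDeriv i φ) := by
    refine (h.compact.fderiv (𝕜 := ℝ)).mono ?_
    intro x hx hx'
    apply hx
    simp only [partialDeriv, hx', zero_apply]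
  exact (hc.memLp_of_hasCompactSupport hs).restrict A

theorem IsWeakPartial.zero (A : Set Plane) (i : Fin 2) : IsWeakPartial A i 0 0 := by
  intro φ _
  have h0 : ((0 : L2 A) : Plane → ℝ) =ᵐ[volume.restrict A] 0 := Lp.coeFn_zero _ _ _
  rw [integral_eq_zero_of_ae (h0.mono fun x hx => by rw [hx]; simp),
    integral_eq_zero_of_ae (h0.mono fun x hx => by rw [hx]; simp), neg_zero]

theorem IsWeakPartial.add {A : Set Plane} {i : Fin 2} {u g v k : L2 A}
    (hu : IsWeakPartial A i u g) (hv : IsWeakPartial A i v k) :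
    IsWeakPartial A i (u + v) (g + k) := by
  intro φ hφ
  have key : ∀ (w z : L2 A) (η : Plane → ℝ), MemLp η 2 (volume.restrict A) →
      ∫ x in A, (w + z : L2 A) x * η x = (∫ x in A, w x * η x) + ∫ x in A, z x * η x := by
    intro w z η hη
    have hw : Integrable (fun x => w x * η x) (volume.restrict A) :=
      (Lp.memLp w).integrable_mul hη
    have hz : Integrable (fun x => z x * η x) (volume.restrict A) :=
      (Lp.memLp z).integrable_mul hη
    rw [← integral_add hw hz]
    exact integral_congr_ae ((Lp.coeFn_add w z).mono fun x hx => by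
      simp only [hx, Pi.add_apply, add_mul])
  rw [key _ _ _ (hφ.memLp_partialDeriv i), key _ _ _ hφ.memLp, hu φ hφ, hv φ hφ, neg_add]

theorem IsWeakPartial.smul {A : Set Plane} {i : Fin 2} {u g : L2 A} (c : ℝ)
    (hu : IsWeakPartial A i u g) : IsWeakPartial A i (c • u) (c • g) := by
  intro φ hφ
  have e1 : ∫ x in A, (c • u : L2 A) x * partialDeriv i φ x
      = ∫ x in A, c * (u x * partialDeriv i φ x) :=
    integral_congr_ae ((Lp.coeFn_smul c u).mono fun x hx => by
      simp only [hx, Pi.smul_apply, smul_eq_mul, mul_assoc])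
  have e2 : ∫ x in A, (c • g : L2 A) x * φ x = ∫ x in A, c * (g x * φ x) :=
    integral_congr_ae ((Lp.coeFn_smul c g).mono fun x hx => by
      simp only [hx, Pi.smul_apply, smul_eq_mul, mul_assoc])
  rw [e1, e2, integral_const_mul, integral_const_mul, hu φ hφ, mul_neg]

/-- Pairs `(u, ∇u)` of a function `u ∈ L²(A)` and its weak gradient in `L²(A)²`. -/
def weakGraph (A : Set Plane) :
    Submodule ℝ (WithLp 2 (L2 A × PiLp 2 (fun _ : Fin 2 => L2 A))) where
  carrier := {p | ∀ i, IsWeakPartial A i p.fst (p.snd i)}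
  zero_mem' := fun i => IsWeakPartial.zero A i
  add_mem' := fun hp hq i => (hp i).add (hq i)
  smul_mem' := fun c _ hp i => (hp i).smul c

/-- The Sobolev space `H¹(A)`: a function `u ∈ L²(A)` together with its weak gradient in
`L²(A)²` (unique for open `A`), with `‖u‖² = ‖u‖²_{L²} + ‖∇u‖²_{L²}`. -/
def H1 (A : Set Plane) : Type := weakGraph A

instance (A : Set Plane) : NormedAddCommGroup (H1 A) :=
  inferInstanceAs (NormedAddCommGroup (weakGraph A))

instance (A : Set Plane) : InnerProductSpace ℝ (H1 A) :=
  inferInstanceAs (InnerProductSpace ℝ (weakGraph A))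

/-- The underlying function of an element of `H¹(A)`. -/
def fn {A : Set Plane} (u : H1 A) : L2 A := u.1.fst

/-- The weak partial derivative `∂ᵢ u` of an element of `H¹(A)`. -/
def pd {A : Set Plane} (i : Fin 2) (u : H1 A) : L2 A := u.1.snd i

theorem isTest_zero (A : Set Plane) : IsTest A 0 :=
  ⟨contDiff_const, HasCompactSupport.zero, by simp [tsupport]⟩

theorem IsTest.add {A : Set Plane} {φ η : Plane → ℝ} (hφ : IsTest A φ) (hη : IsTest A η) :
    IsTest A (φ + η) :=
  ⟨hφ.smooth.add hη.smooth, hφ.compact.add hη.compact,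
    (tsupport_add φ η).trans (Set.union_subset hφ.supp hη.supp)⟩

theorem IsTest.smul {A : Set Plane} {φ : Plane → ℝ} (c : ℝ) (hφ : IsTest A φ) :
    IsTest A (c • φ) :=
  ⟨hφ.smooth.const_smul c, hφ.compact.smul_left (f := fun _ => c),
    (tsupport_smul_subset_right (fun _ => c) φ).trans hφ.supp⟩

/-- The image of the space of test functions `C_c^∞(A)` in `H¹(A)`. -/
def testSpace (A : Set Plane) : Submodule ℝ (H1 A) where
  carrier := {u | ∃ φ : Plane → ℝ, IsTest A φ ∧ fn u =ᵐ[volume.restrict A] φ}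
  zero_mem' := ⟨0, isTest_zero A, Lp.coeFn_zero _ _ _⟩
  add_mem' := by
    rintro u v ⟨φ, hφ, hu⟩ ⟨η, hη, hv⟩
    exact ⟨φ + η, hφ.add hη, (Lp.coeFn_add (fn u) (fn v)).trans (hu.add hv)⟩
  smul_mem' := by
    rintro c u ⟨φ, hφ, hu⟩
    exact ⟨c • φ, hφ.smul c, (Lp.coeFn_smul c (fn u)).trans (hu.const_smul c)⟩

/-- `H¹₀(A)`, the closure of `C_c^∞(A)` in `H¹(A)`. -/
def H10 (A : Set Plane) : Submodule ℝ (H1 A) := (testSpace A).topologicalClosure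

/-- `Y₀(A) = H¹₀(A) ⊗ Sym(2)`: symmetric `2 × 2` tensor fields with components in `H¹₀(A)`,
with `‖σ‖² = ∑ᵢⱼ ‖σᵢⱼ‖²_{H¹} = ‖σ‖²_{L²} + ‖Dσ‖²_{L²}`. -/
def Y0 (A : Set Plane) : Submodule ℝ (PiLp 2 (fun _ : Fin 2 × Fin 2 => H1 A)) where
  carrier := {σ | ∀ i j, σ (i, j) ∈ H10 A ∧ σ (i, j) = σ (j, i)}
  zero_mem' := fun _ _ => ⟨zero_mem _, rfl⟩
  add_mem' := fun hσ hτ i j =>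
    ⟨add_mem (hσ i j).1 (hτ i j).1, congrArg₂ (· + ·) (hσ i j).2 (hτ i j).2⟩
  smul_mem' := fun c _ hσ i j =>
    ⟨Submodule.smul_mem _ c (hσ i j).1, congrArg (c • ·) (hσ i j).2⟩

/-- The component `σᵢⱼ`. -/
def comp {A : Set Plane} (σ : Y0 A) (i j : Fin 2) : H1 A := σ.1 (i, j)

/-- The `i`-th component `∑ⱼ ∂ⱼ σᵢⱼ` of the row-wise divergence `Div σ`. -/
def Div {A : Set Plane} (σ : Y0 A) (i : Fin 2) : L2 A := ∑ j, pd j (comp σ i j)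

/-- The trace `tr σ = ∑ᵢ σᵢᵢ`. -/
def tr {A : Set Plane} (σ : Y0 A) : H1 A := ∑ i, comp σ i i

/-- The component `(sym D f)ᵢⱼ = (∂ⱼ fᵢ + ∂ᵢ fⱼ) / 2`. -/
def symD {A : Set Plane} (f : Fin 2 → H1 A) (i j : Fin 2) : L2 A :=
  (1 / 2 : ℝ) • (pd j (f i) + pd i (f j))

/-- The divergence `div f = ∑ᵢ ∂ᵢ fᵢ` of a vector field. -/
def div {A : Set Plane} (f : Fin 2 → H1 A) : L2 A := ∑ i, pd i (f i)

/-- `a(τ, σ) = ∫_A ψ ⟨Div τ, Div σ⟩ + χ ⟨∇ tr τ, ∇ tr σ⟩ dA`. -/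
def form {A : Set Plane} (ψ χ : ℝ) (τ σ : Y0 A) : ℝ :=
  ∫ x in A, (ψ * (∑ i, Div τ i x * Div σ i x) + χ * (∑ i, pd i (tr τ) x * pd i (tr σ) x))

/-- `l(τ) = ∫_A ψ ⟨τ, sym D f⟩ + ⟨tr τ, div f⟩ dA`. -/
def load {A : Set Plane} (ψ : ℝ) (f : Fin 2 → H1 A) (τ : Y0 A) : ℝ :=
  ∫ x in A, (ψ * (∑ i, ∑ j, fn (comp τ i j) x * symD f i j x) + fn (tr τ) x * div f x)

end PlanarStress

end

namespace PlanarStress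

variable {A : Set Plane}

/-! ### Calculus of test functions and `L²` pairings. -/

section Calculus

/-! Everything reduces to coercivity; Lax–Milgram on the Hilbert space `Y0 A` does the rest.
Coercivity has two ingredients. First, `Div σ` and `∇ tr σ` control all of `Dσ`
(`sum_norm_sq_pd_le`). Expanding `‖Div σ‖²` leaves the cross terms `2⟨∂₀σ₀₀, ∂₁σ₀₁⟩ + 2⟨∂₀σ₀₁,
∂₁σ₁₁⟩`. Two integrations by parts exchange the derivatives in the first (`inner_pd_pd_swap`), so
the sum becomes `2⟨∂₀σ₀₁, ∂₁ tr σ⟩`, which Young's inequality absorbs. The two missing derivatives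
`∂₁σ₀₀` and `∂₀σ₁₁` are recovered from `∇ tr σ`. Second, the Poincaré inequality (`norm_fn_le`)
bounds each component by its gradient, since `A` is bounded. -/

theorem setIntegral_mul_eq_inner (u : L2 A) {η : Plane → ℝ} (hη : MemLp η 2 (volume.restrict A)) :
    ∫ x in A, u x * η x = inner ℝ u (hη.toLp η) := by
  rw [L2.inner_def]
  refine integral_congr_ae (hη.coeFn_toLp.mono fun x hx => ?_)
  simp [hx, mul_comm]

theorem setIntegral_mul_coe_eq_inner (u v : L2 A) : ∫ x in A, u x * v x = inner ℝ u v := by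
  rw [L2.inner_def]
  exact integral_congr_ae (.of_forall fun x => by simp [mul_comm])

theorem integrable_mul_coe (u v : L2 A) :
    Integrable (fun x => u x * v x) (volume.restrict A) :=
  (Lp.memLp u).integrable_mul (Lp.memLp v)

theorem contDiff_partialDeriv {φ : Plane → ℝ} (h : ContDiff ℝ ∞ φ) (i : Fin 2) :
    ContDiff ℝ ∞ (partialDeriv i φ) :=
  (h.fderiv_right (m := ∞) (by simp)).clm_apply contDiff_const

theorem IsTest.partialDeriv {φ : Plane → ℝ} (h : IsTest A φ) (i : Fin 2) :
    IsTest A (partialDeriv i φ) := by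
  have hs : tsupport (PlanarStress.partialDeriv i φ) ⊆ tsupport φ :=
    tsupport_fderiv_apply_subset ℝ _
  exact ⟨contDiff_partialDeriv h.smooth i,
    h.compact.of_isClosed_subset (isClosed_tsupport _) hs, hs.trans h.supp⟩

theorem IsTest.mul_left {φ g : Plane → ℝ} (h : IsTest A φ) (hg : ContDiff ℝ ∞ g) :
    IsTest A (g * φ) :=
  ⟨hg.mul h.smooth, h.compact.mul_left, (tsupport_mul_subset_right).trans h.supp⟩

theorem partialDeriv_comm {φ : Plane → ℝ} (h : ContDiff ℝ ∞ φ) (i j : Fin 2) :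
    partialDeriv i (partialDeriv j φ) = partialDeriv j (partialDeriv i φ) := by
  have hd : Differentiable ℝ (fderiv ℝ φ) :=
    (h.fderiv_right (m := ∞) (by simp)).differentiable (by simp)
  have key : ∀ (k l : Fin 2) (x : Plane), partialDeriv k (partialDeriv l φ) x =
      fderiv ℝ (fderiv ℝ φ) x (EuclideanSpace.single k 1) (EuclideanSpace.single l 1) := by
    intro k l x
    have := ((hd x).hasFDerivAt.clm_apply
      (hasFDerivAt_const (EuclideanSpace.single l (1 : ℝ)) x)).fderiv
    change fderiv ℝ (fun y => fderiv ℝ φ y (EuclideanSpace.single l 1)) x _ = _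
    rw [this]
    simp
  funext x
  rw [key, key]
  exact (h.contDiffAt.isSymmSndFDerivAt (by
    rw [minSmoothness_of_isRCLikeNormedField]
    exact WithTop.coe_le_coe.2 (le_top : (2 : ℕ∞) ≤ ⊤))) _ _

/-- Both integrands vanish off `A`, so this is integration by parts on the whole plane, without
boundary terms. -/
theorem IsTest.setIntegral_mul_partialDeriv {φ η : Plane → ℝ} (hφ : IsTest A φ)
    (hη : IsTest A η) (i : Fin 2) :
    ∫ x in A, φ x * PlanarStress.partialDeriv i η x =
      -∫ x in A, PlanarStress.partialDeriv i φ x * η x := by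
  have zero : ∀ {f : Plane → ℝ}, IsTest A f → ∀ x ∉ A, f x = 0 := fun hf x hx =>
    image_eq_zero_of_notMem_tsupport fun h => hx (hf.supp h)
  have int : ∀ {f g : Plane → ℝ}, IsTest A f → IsTest A g →
      Integrable (fun x => f x * g x) := fun {f g} hf hg =>
    (hf.smooth.continuous.mul hg.smooth.continuous).integrable_of_hasCompactSupport
      (hf.compact.mul_right (f' := g))
  rw [setIntegral_eq_integral_of_forall_compl_eq_zero fun x hx => by rw [zero hφ x hx, zero_mul],
    setIntegral_eq_integral_of_forall_compl_eq_zero fun x hx => by rw [zero hη x hx, mul_zero]]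
  exact integral_mul_fderiv_eq_neg_fderiv_mul_of_integrable (int (hφ.partialDeriv i) hη)
    (int hφ (hη.partialDeriv i)) (int hφ hη)
    (fun x _ => hφ.smooth.differentiable (by simp) x)
    (fun x _ => hη.smooth.differentiable (by simp) x)

end Calculus

/-! ### Weak gradients, completeness and the Poincaré inequality. -/

section Sobolev

theorem isWeakPartial_pd (u : H1 A) (i : Fin 2) : IsWeakPartial A i (fn u) (pd i u) := u.2 i

/-- The weak gradient of a test function is its classical gradient. -/
theorem pd_ae_eq_partialDeriv (hA : IsOpen A) {u : H1 A} {φ : Plane → ℝ} (hφ : IsTest A φ)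
    (hu : fn u =ᵐ[volume.restrict A] φ) (i : Fin 2) :
    pd i u =ᵐ[volume.restrict A] partialDeriv i φ := by
  have hp := hφ.memLp_partialDeriv i
  have hf : MemLp (fun x => pd i u x - partialDeriv i φ x) 2 (volume.restrict A) :=
    (Lp.memLp (pd i u)).sub hp
  -- Fundamental lemma of the calculus of variations: weak and classical derivative have the same
  -- integral against every test function.
  have := hA.ae_eq_zero_of_integral_contDiff_smul_eq_zero (μ := volume.restrict A)
    ((hf.locallyIntegrable (by norm_num)).locallyIntegrableOn A) (by
      intro η h1 h2 h3
      have hη : IsTest A η := ⟨h1, h2, h3⟩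
      have e : ∫ x in A, fn u x * partialDeriv i η x = ∫ x in A, φ x * partialDeriv i η x :=
        integral_congr_ae (hu.mono fun x hx => by simp only [hx])
      rw [isWeakPartial_pd u i η hη, hφ.setIntegral_mul_partialDeriv hη] at e
      have i1 : Integrable (fun x => pd i u x * η x) (volume.restrict A) :=
        (Lp.memLp (pd i u)).integrable_mul hη.memLp
      have i2 : Integrable (fun x => partialDeriv i φ x * η x) (volume.restrict A) :=
        hp.integrable_mul hη.memLp
      have e2 : ∀ x, η x • (pd i u x - partialDeriv i φ x) =
          pd i u x * η x - partialDeriv i φ x * η x := fun x => by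
        rw [smul_eq_mul]; ring
      simp_rw [e2]
      rw [integral_sub i1 i2]
      linarith)
  filter_upwards [this, ae_restrict_mem hA.measurableSet] with x h1 h2
  exact sub_eq_zero.1 (h1 h2)

theorem norm_sq_eq (u : H1 A) : ‖u‖ ^ 2 = ‖fn u‖ ^ 2 + ∑ i, ‖pd i u‖ ^ 2 := by
  have h := WithLp.prod_norm_sq_eq_of_L2 u.1
  rw [PiLp.norm_sq_eq_of_L2] at h
  exact h

/-- The map `u ↦ u` from `H¹(A)` to `L²(A)`. -/
noncomputable def fnL (A : Set Plane) : H1 A →L[ℝ] L2 A :=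
  (WithLp.fstL 2 ℝ _ _).comp (weakGraph A).subtypeL

/-- The map `u ↦ ∂ᵢ u` from `H¹(A)` to `L²(A)`. -/
noncomputable def pdL (A : Set Plane) (i : Fin 2) : H1 A →L[ℝ] L2 A :=
  ((PiLp.proj 2 (fun _ : Fin 2 => L2 A) i).comp (WithLp.sndL 2 ℝ _ _)).comp (weakGraph A).subtypeL

@[simp] theorem fnL_apply (u : H1 A) : fnL A u = fn u := rfl

@[simp] theorem pdL_apply (i : Fin 2) (u : H1 A) : pdL A i u = pd i u := rfl

theorem norm_pd_le (i : Fin 2) (u : H1 A) : ‖pd i u‖ ≤ ‖u‖ := by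
  refine abs_le_of_sq_le_sq' ?_ (norm_nonneg _) |>.2
  rw [norm_sq_eq]
  have := Finset.single_le_sum (f := fun i => ‖pd i u‖ ^ 2) (fun i _ => sq_nonneg _)
    (Finset.mem_univ i)
  nlinarith [sq_nonneg ‖fn u‖]

/-- Each test function imposes an equation between continuous functionals of `(u, ∇u)`. Closedness
gives completeness of `H1 A`. -/
theorem isClosed_weakGraph (A : Set Plane) :
    IsClosed (weakGraph A : Set (WithLp 2 (L2 A × PiLp 2 (fun _ : Fin 2 => L2 A)))) := by
  have e : (weakGraph A : Set (WithLp 2 (L2 A × PiLp 2 (fun _ : Fin 2 => L2 A)))) =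
      ⋂ (i : Fin 2) (φ : Plane → ℝ) (hφ : IsTest A φ),
        {p | inner ℝ (WithLp.fstL 2 ℝ (L2 A) _ p) ((hφ.memLp_partialDeriv i).toLp _) =
          -inner ℝ (PiLp.proj (𝕜 := ℝ) 2 (fun _ : Fin 2 => L2 A) i (WithLp.sndL 2 ℝ _ _ p))
            (hφ.memLp.toLp φ)} := by
    ext p
    simp only [Set.mem_iInter, Set.mem_ofPred_eq, ← setIntegral_mul_eq_inner]
    rfl
  rw [e]
  refine isClosed_iInter fun i => isClosed_iInter fun φ => isClosed_iInter fun hφ => ?_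
  exact isClosed_eq (by fun_prop) (by fun_prop)

instance (A : Set Plane) : CompleteSpace (H1 A) :=
  (isClosed_weakGraph A).completeSpace_coe

/-- The `L²` inner product of mixed partial derivatives is symmetric in the derivatives. -/
theorem inner_pd_pd_swap (hA : IsOpen A) (u : H1 A) {v : H1 A} (hv : v ∈ H10 A) (i j : Fin 2) :
    inner ℝ (pd i u) (pd j v) = (inner ℝ (pd j u) (pd i v) : ℝ) := by
  -- Both sides are continuous in `v`, so test functions suffice; `u` needs no boundary condition.
  have hcl : IsClosed {v : H1 A |
      inner ℝ (pdL A i u) (pdL A j v) = (inner ℝ (pdL A j u) (pdL A i v) : ℝ)} :=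
    isClosed_eq (by fun_prop) (by fun_prop)
  refine closure_minimal ?_ hcl hv
  rintro v ⟨φ, hφ, hvφ⟩
  have key : ∀ k l : Fin 2, (inner ℝ (pd k u) (pd l v) : ℝ) =
      -∫ x in A, fn u x * partialDeriv k (partialDeriv l φ) x := by
    intro k l
    rw [isWeakPartial_pd u k _ (hφ.partialDeriv l), neg_neg, ← setIntegral_mul_coe_eq_inner]
    exact integral_congr_ae
      ((pd_ae_eq_partialDeriv hA hφ hvφ l).mono fun x hx => by simp only [hx])
  simp only [Set.mem_ofPred_eq, pdL_apply]
  rw [key, key, partialDeriv_comm hφ.smooth]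

/-- The Poincaré inequality. -/
theorem norm_fn_le (hA : IsOpen A) {R : ℝ} (hR : ∀ x ∈ A, ‖x‖ ≤ R) {v : H1 A}
    (hv : v ∈ H10 A) (i : Fin 2) : ‖fn v‖ ^ 2 ≤ 2 * R * (‖fn v‖ * ‖pd i v‖) := by
  have hcl : IsClosed {v : H1 A |
      ‖fnL A v‖ ^ 2 ≤ 2 * R * (‖fnL A v‖ * ‖pdL A i v‖)} :=
    isClosed_le (by fun_prop) (by fun_prop)
  refine closure_minimal ?_ hcl hv
  rintro v ⟨φ, hφ, hvφ⟩
  simp only [Set.mem_ofPred_eq, fnL_apply, pdL_apply]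
  have hg : ContDiff ℝ ∞ (fun x : Plane => x i) := by fun_prop
  have hd : ∀ x, partialDeriv i ((fun x : Plane => x i) * φ) x =
      φ x + x i * partialDeriv i φ x := by
    intro x
    have h1 : HasFDerivAt (fun x : Plane => x i) (EuclideanSpace.proj (𝕜 := ℝ) i) x :=
      (EuclideanSpace.proj (𝕜 := ℝ) i : Plane →L[ℝ] ℝ).hasFDerivAt
    have h2 := (hφ.smooth.differentiable (by simp) x).hasFDerivAt
    unfold partialDeriv
    rw [(h1.mul h2).fderiv]
    simp
    ring
  have hpd := pd_ae_eq_partialDeriv hA hφ hvφ i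
  -- Testing with `xᵢ φ`, where `v = φ` on `A`, yields `∫ v² = -2 ∫ xᵢ v ∂ᵢv`.
  have ei := isWeakPartial_pd v i _ (hφ.mul_left hg)
  have hxA := ae_restrict_mem (μ := volume) hA.measurableSet
  have hcoord : ∀ x ∈ A, |x i| ≤ R := fun x hx => (PiLp.norm_apply_le x i).trans (hR x hx)
  have iprod := integrable_mul_coe (fn v) (pd i v)
  have ix : Integrable (fun x : Plane => x i * (fn v x * pd i v x)) (volume.restrict A) :=
    iprod.bdd_mul hg.continuous.aestronglyMeasurable
      (hxA.mono fun x hx => hcoord x hx)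
  have e1 : ∫ x in A, fn v x * partialDeriv i ((fun x : Plane => x i) * φ) x =
      (∫ x in A, fn v x * fn v x) + ∫ x in A, x i * (fn v x * pd i v x) := by
    rw [← integral_add (integrable_mul_coe _ _) ix]
    refine integral_congr_ae ?_
    filter_upwards [hvφ, hpd] with x h1 h2
    rw [hd, h1, h2]
    ring
  have e2 : ∫ x in A, pd i v x * ((fun x : Plane => x i) * φ) x =
      ∫ x in A, x i * (fn v x * pd i v x) := by
    refine integral_congr_ae ?_
    filter_upwards [hvφ] with x h1
    rw [Pi.mul_apply, h1]
    ring
  rw [e1, e2, setIntegral_mul_coe_eq_inner, real_inner_self_eq_norm_sq] at ei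
  have iabs := (Lp.memLp (fn v)).norm.integrable_mul (Lp.memLp (pd i v)).norm
  have hb : |∫ x in A, x i * (fn v x * pd i v x)| ≤ R * (‖fn v‖ * ‖pd i v‖) := by
    have hn : ∀ w : L2 A, ‖(Lp.memLp w).norm.toLp‖ = ‖w‖ := fun w => by
      rw [Lp.norm_toLp, Lp.norm_def, eLpNorm_norm]
    have hi : ∫ x in A, ‖fn v x‖ * ‖pd i v x‖ ≤ ‖fn v‖ * ‖pd i v‖ := by
      have h0 : ∫ x in A, ‖fn v x‖ * ‖pd i v x‖ =
          inner ℝ (Lp.memLp (fn v)).norm.toLp (Lp.memLp (pd i v)).norm.toLp := by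
        rw [← setIntegral_mul_eq_inner]
        exact integral_congr_ae
          ((Lp.memLp (fn v)).norm.coeFn_toLp.mono fun x hx => by simp only [hx])
      rw [h0, ← hn (fn v), ← hn (pd i v)]
      exact real_inner_le_norm _ _
    have hRi : ∫ x in A, ‖x i * (fn v x * pd i v x)‖ ≤
        ∫ x in A, R * (‖fn v x‖ * ‖pd i v x‖) := by
      refine integral_mono_ae ix.norm (iabs.const_mul R) (hxA.mono fun x hx => ?_)
      simp only [norm_mul]
      exact mul_le_mul_of_nonneg_right (hcoord x hx) (by positivity)
    rw [integral_const_mul] at hRi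
    have h0 : ∫ x in A, ‖x i * (fn v x * pd i v x)‖ ≤ R * (‖fn v‖ * ‖pd i v‖) := by
      -- `R` may be negative when `A` is empty.
      rcases A.eq_empty_or_nonempty with rfl | ⟨y, hy⟩
      · refine hRi.trans ?_
        have hz : ∀ w : L2 (∅ : Set Plane), ‖w‖ = 0 := fun w => by
          rw [Lp.norm_def]; simp
        simp [hz]
      · exact hRi.trans (mul_le_mul_of_nonneg_left hi ((norm_nonneg y).trans (hR y hy)))
    exact (norm_integral_le_integral_norm _).trans h0
  have := (abs_le.1 hb).1
  linarith

theorem norm_sq_le_of_mem_H10 (hA : IsOpen A) {R : ℝ} (hR : ∀ x ∈ A, ‖x‖ ≤ R) {v : H1 A}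
    (hv : v ∈ H10 A) : ‖v‖ ^ 2 ≤ (1 + 4 * R ^ 2) * ∑ i, ‖pd i v‖ ^ 2 := by
  have h := norm_fn_le hA hR hv 0
  rw [norm_sq_eq, Fin.sum_univ_two]
  -- The first square turns the Poincaré inequality into `‖v‖² ≤ 4R² ‖∂₀v‖²` in `L²`, without
  -- dividing by `‖v‖`.
  nlinarith [sq_nonneg (‖fn v‖ - 2 * R * ‖pd 0 v‖), mul_nonneg (sq_nonneg R) (sq_nonneg ‖pd 1 v‖)]

end Sobolev

/-! ### Tensor fields and continuity of the form. -/

section Tensor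

/-- The map `σ ↦ σᵢⱼ`. -/
noncomputable def compL (A : Set Plane) (i j : Fin 2) : Y0 A →L[ℝ] H1 A :=
  (PiLp.proj 2 (fun _ : Fin 2 × Fin 2 => H1 A) (i, j)).comp (Y0 A).subtypeL

/-- The map `σ ↦ (Div σ)ᵢ`. -/
noncomputable def DivL (A : Set Plane) (i : Fin 2) : Y0 A →L[ℝ] L2 A := ∑ j, (pdL A j).comp (compL A i j)

/-- The map `σ ↦ tr σ`. -/
noncomputable def trL (A : Set Plane) : Y0 A →L[ℝ] H1 A := ∑ i, compL A i i

@[simp] theorem compL_apply (i j : Fin 2) (σ : Y0 A) : compL A i j σ = comp σ i j := rfl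

@[simp] theorem DivL_apply (i : Fin 2) (σ : Y0 A) : DivL A i σ = Div σ i := by
  simp [DivL, Div, Fin.sum_univ_two]

@[simp] theorem trL_apply (σ : Y0 A) : trL A σ = tr σ := by simp [trL, tr, Fin.sum_univ_two]

theorem comp_mem_H10 (σ : Y0 A) (i j : Fin 2) : comp σ i j ∈ H10 A := (σ.2 i j).1

theorem comp_symm (σ : Y0 A) (i j : Fin 2) : comp σ i j = comp σ j i := (σ.2 i j).2

theorem isClosed_Y0 (A : Set Plane) :
    IsClosed (Y0 A : Set (PiLp 2 (fun _ : Fin 2 × Fin 2 => H1 A))) := by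
  have e : (Y0 A : Set (PiLp 2 (fun _ : Fin 2 × Fin 2 => H1 A))) =
      ⋂ (i : Fin 2) (j : Fin 2),
        ((fun σ => PiLp.proj (𝕜 := ℝ) 2 (fun _ : Fin 2 × Fin 2 => H1 A) (i, j) σ) ⁻¹' (H10 A) ∩
          {σ | PiLp.proj (𝕜 := ℝ) 2 (fun _ : Fin 2 × Fin 2 => H1 A) (i, j) σ =
            PiLp.proj (𝕜 := ℝ) 2 (fun _ : Fin 2 × Fin 2 => H1 A) (j, i) σ}) := by
    ext σ
    simp only [Set.mem_iInter]
    rfl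
  rw [e]
  refine isClosed_iInter fun i => isClosed_iInter fun j => IsClosed.inter ?_ ?_
  · exact (Submodule.isClosed_topologicalClosure _).preimage (by fun_prop)
  · exact isClosed_eq (by fun_prop) (by fun_prop)

instance (A : Set Plane) : CompleteSpace (Y0 A) := (isClosed_Y0 A).completeSpace_coe

theorem norm_comp_le (σ : Y0 A) (i j : Fin 2) : ‖comp σ i j‖ ≤ ‖σ‖ :=
  PiLp.norm_apply_le σ.1 (i, j)

theorem norm_sq_eq_sum_comp (σ : Y0 A) : ‖σ‖ ^ 2 = ∑ i, ∑ j, ‖comp σ i j‖ ^ 2 := by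
  rw [← Fintype.sum_prod_type']
  exact PiLp.norm_sq_eq_of_L2 _ σ.1

theorem norm_Div_le (σ : Y0 A) (i : Fin 2) : ‖Div σ i‖ ≤ 2 * ‖σ‖ := by
  rw [Div, Fin.sum_univ_two]
  refine (norm_add_le _ _).trans ?_
  linarith [(norm_pd_le 0 _).trans (norm_comp_le σ i 0), (norm_pd_le 1 _).trans (norm_comp_le σ i 1)]

theorem pd_tr (σ : Y0 A) (i : Fin 2) :
    pd i (tr σ) = pd i (comp σ 0 0) + pd i (comp σ 1 1) := by
  rw [tr, Fin.sum_univ_two, ← pdL_apply, map_add, pdL_apply, pdL_apply]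

theorem norm_pd_tr_le (σ : Y0 A) (i : Fin 2) : ‖pd i (tr σ)‖ ≤ 2 * ‖σ‖ := by
  rw [pd_tr]
  refine (norm_add_le _ _).trans ?_
  linarith [(norm_pd_le i _).trans (norm_comp_le σ 0 0), (norm_pd_le i _).trans (norm_comp_le σ 1 1)]

theorem form_eq_inner (ψ χ : ℝ) (τ σ : Y0 A) :
    form ψ χ τ σ = ψ * (∑ i, inner ℝ (Div τ i) (Div σ i)) +
      χ * ∑ i, inner ℝ (pd i (tr τ)) (pd i (tr σ)) := by
  have h1 := integrable_finsetSum Finset.univ fun i _ => integrable_mul_coe (Div τ i) (Div σ i)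
  have h2 := integrable_finsetSum Finset.univ fun i _ =>
    integrable_mul_coe (pd i (tr τ)) (pd i (tr σ))
  rw [form, integral_add (h1.const_mul ψ) (h2.const_mul χ), integral_const_mul,
    integral_const_mul, integral_finsetSum _ fun i _ => integrable_mul_coe _ _,
    integral_finsetSum _ fun i _ => integrable_mul_coe _ _]
  simp only [setIntegral_mul_coe_eq_inner]

theorem form_symm (ψ χ : ℝ) (τ σ : Y0 A) : form ψ χ τ σ = form ψ χ σ τ := by
  simp only [form_eq_inner, real_inner_comm]

/-- The form `a` as a continuous bilinear map. -/
noncomputable def formL (A : Set Plane) (ψ χ : ℝ) : Y0 A →L[ℝ] Y0 A →L[ℝ] ℝ :=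
  ψ • (∑ i, (innerSL ℝ).bilinearComp (DivL A i) (DivL A i)) +
    χ • ∑ i, (innerSL ℝ).bilinearComp ((pdL A i).comp (trL A)) ((pdL A i).comp (trL A))

theorem formL_apply (ψ χ : ℝ) (τ σ : Y0 A) : formL A ψ χ τ σ = form ψ χ τ σ := by
  rw [form_eq_inner]
  simp [formL, Fin.sum_univ_two, mul_add]

theorem abs_form_le {ψ χ : ℝ} (hψ : 0 ≤ ψ) (hχ : 0 ≤ χ) (τ σ : Y0 A) :
    |form ψ χ τ σ| ≤ 8 * (ψ + χ) * ‖τ‖ * ‖σ‖ := by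
  have key : ∀ u v : L2 A, ‖u‖ ≤ 2 * ‖τ‖ → ‖v‖ ≤ 2 * ‖σ‖ →
      |(inner ℝ u v : ℝ)| ≤ 4 * (‖τ‖ * ‖σ‖) := fun u v hu hv =>
    (abs_real_inner_le_norm u v).trans
      ((mul_le_mul hu hv (norm_nonneg _) (by positivity)).trans_eq (by ring))
  have hs : ∀ a b c : ℝ, |a| ≤ c → |b| ≤ c → |a + b| ≤ 2 * c := fun a b c ha hb =>
    (abs_add_le a b).trans (by linarith)
  rw [form_eq_inner, Fin.sum_univ_two, Fin.sum_univ_two]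
  refine (abs_add_le _ _).trans ?_
  rw [abs_mul, abs_mul, abs_of_nonneg hψ, abs_of_nonneg hχ]
  have h1 := hs _ _ _ (key _ _ (norm_Div_le τ 0) (norm_Div_le σ 0))
    (key _ _ (norm_Div_le τ 1) (norm_Div_le σ 1))
  have h2 := hs _ _ _ (key _ _ (norm_pd_tr_le τ 0) (norm_pd_tr_le σ 0))
    (key _ _ (norm_pd_tr_le τ 1) (norm_pd_tr_le σ 1))
  linarith [mul_le_mul_of_nonneg_left h1 hψ, mul_le_mul_of_nonneg_left h2 hχ]

/-! ### Coercivity. -/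

/-- The full gradient of `σ` is controlled by `Div σ` and `∇ tr σ`. -/
theorem sum_norm_sq_pd_le (hA : IsOpen A) (σ : Y0 A) :
    ∑ i, ∑ j, ∑ k, ‖pd k (comp σ i j)‖ ^ 2 ≤
      5 * ((∑ i, ‖Div σ i‖ ^ 2) + 2 * ∑ i, ‖pd i (tr σ)‖ ^ 2) := by
  have hs := comp_symm σ 1 0
  have swap1 := inner_pd_pd_swap hA (comp σ 0 0) (comp_mem_H10 σ 0 1) 0 1
  simp only [Fin.sum_univ_two, Div, pd_tr, hs]
  set a0 := pd 0 (comp σ 0 0)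
  set a1 := pd 1 (comp σ 0 0)
  set b0 := pd 0 (comp σ 0 1)
  set b1 := pd 1 (comp σ 0 1)
  set c0 := pd 0 (comp σ 1 1)
  set c1 := pd 1 (comp σ 1 1)
  have e1 := norm_add_sq_real a0 b1
  have e2 := norm_add_sq_real b0 c1
  -- The weight `1/2` leaves half of the `‖b0‖²` supplied by `e2`.
  have young : -(2 * inner ℝ b0 (a1 + c1)) ≤ 1 / 2 * ‖b0‖ ^ 2 + 2 * ‖a1 + c1‖ ^ 2 := by
    have := (abs_le.1 (abs_real_inner_le_norm b0 (a1 + c1))).1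
    nlinarith [sq_nonneg (‖b0‖ - 2 * ‖a1 + c1‖)]
  rw [inner_add_right, real_inner_comm a1 b0] at young
  have tri : ∀ u v : L2 A, ‖v‖ ^ 2 ≤ 2 * ‖u + v‖ ^ 2 + 2 * ‖u‖ ^ 2 := by
    intro u v
    have h := norm_sub_le (u + v) u
    rw [add_sub_cancel_left] at h
    nlinarith [norm_nonneg v, norm_nonneg u, norm_nonneg (u + v), sq_nonneg (‖u + v‖ - ‖u‖)]
  have t1 := tri a0 c0
  have t2 := tri c1 a1
  rw [add_comm c1 a1] at t2
  -- With `D = ‖Div σ‖²` and `T = ‖∇ tr σ‖²`, `e1`, `e2`, the swap and `young` bound `‖a0‖² + ‖b1‖²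
  -- + ‖b0‖²/2 + ‖c1‖²` by `D + 2T`. Four times this, plus `2T` from `t1` and `t2`, bounds the left
  -- side by `4D + 10T`.
  nlinarith [sq_nonneg ‖a0‖, sq_nonneg ‖b0‖, sq_nonneg ‖b1‖, sq_nonneg ‖c1‖,
    sq_nonneg ‖a0 + c0‖, sq_nonneg ‖a1 + c1‖]

theorem norm_sq_le_form (hA : IsOpen A) {R : ℝ} (hR : ∀ x ∈ A, ‖x‖ ≤ R) {ψ χ : ℝ}
    (hψ : 0 < ψ) (hχ : 0 < χ) (σ : Y0 A) :
    ‖σ‖ ^ 2 ≤ (1 + 4 * R ^ 2) * (5 * (1 / ψ + 2 / χ)) * form ψ χ σ σ := by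
  have h1 : ‖σ‖ ^ 2 ≤ (1 + 4 * R ^ 2) * ∑ i, ∑ j, ∑ k, ‖pd k (comp σ i j)‖ ^ 2 := by
    rw [norm_sq_eq_sum_comp]
    simp only [Finset.mul_sum (s := Finset.univ) (a := 1 + 4 * R ^ 2)]
    refine Finset.sum_le_sum fun i _ => Finset.sum_le_sum fun j _ => ?_
    rw [← Finset.mul_sum]
    exact norm_sq_le_of_mem_H10 hA hR (comp_mem_H10 σ i j)
  have h2 := sum_norm_sq_pd_le hA σ
  have h3 : (∑ i, ‖Div σ i‖ ^ 2) + 2 * ∑ i, ‖pd i (tr σ)‖ ^ 2 ≤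
      (1 / ψ + 2 / χ) * form ψ χ σ σ := by
    rw [form_eq_inner]
    simp only [real_inner_self_eq_norm_sq]
    have hD : 0 ≤ ∑ i, ‖Div σ i‖ ^ 2 := Finset.sum_nonneg fun i _ => sq_nonneg _
    have hT : 0 ≤ ∑ i, ‖pd i (tr σ)‖ ^ 2 := Finset.sum_nonneg fun i _ => sq_nonneg _
    set D := ∑ i, ‖Div σ i‖ ^ 2
    set T := ∑ i, ‖pd i (tr σ)‖ ^ 2
    -- The factor `1/ψ + 2/χ` produces `D + 2T` plus nonnegative mixed terms.
    have : (1 / ψ + 2 / χ) * (ψ * D + χ * T) = D + 2 * T + (χ / ψ * T + 2 * (ψ / χ) * D) := by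
      field_simp
      ring
    rw [this]
    have : 0 ≤ χ / ψ * T + 2 * (ψ / χ) * D := by positivity
    linarith
  calc ‖σ‖ ^ 2 ≤ (1 + 4 * R ^ 2) * (5 * ((1 / ψ + 2 / χ) * form ψ χ σ σ)) :=
        h1.trans (mul_le_mul_of_nonneg_left (by linarith) (by positivity))
    _ = _ := by ring

/-! ### The load functional and Lax–Milgram. -/

/-- The load `l` as a continuous linear functional. -/
noncomputable def loadL (ψ : ℝ) (f : Fin 2 → H1 A) : StrongDual ℝ (Y0 A) :=
  ψ • (∑ i, ∑ j, (innerSL ℝ (symD f i j)).comp ((fnL A).comp (compL A i j))) +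
    (innerSL ℝ (div f)).comp ((fnL A).comp (trL A))

theorem loadL_apply (ψ : ℝ) (f : Fin 2 → H1 A) (τ : Y0 A) : loadL ψ f τ = load ψ f τ := by
  have h1 := fun i => integrable_finsetSum Finset.univ fun j _ =>
    integrable_mul_coe (fn (comp τ i j)) (symD f i j)
  have h2 := integrable_finsetSum Finset.univ fun i _ => h1 i
  rw [load, integral_add (h2.const_mul ψ) (integrable_mul_coe _ _), integral_const_mul,
    integral_finsetSum _ fun i _ => h1 i]
  simp only [integral_finsetSum _ fun j _ => integrable_mul_coe (fn (comp τ _ j)) (symD f _ j),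
    setIntegral_mul_coe_eq_inner]
  simp [loadL, Fin.sum_univ_two, real_inner_comm, mul_add]

/-- Well-posedness of the variational problem for a coercive form. -/
theorem exists_unique_solution {ψ χ β : ℝ} (hβ : 0 < β)
    (h : ∀ σ : Y0 A, β * ‖σ‖ ^ 2 ≤ form ψ χ σ σ) (L : StrongDual ℝ (Y0 A)) :
    ∃ σ : Y0 A, (∀ τ, form ψ χ τ σ = L τ) ∧
      (∀ σ' : Y0 A, (∀ τ, form ψ χ τ σ' = L τ) → σ' = σ) ∧ ‖σ‖ ≤ 1 / β * ‖L‖ := by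
  have hc : IsCoercive (formL A ψ χ) := ⟨β, hβ, fun u => by
    rw [formL_apply, mul_assoc, ← sq]; exact h u⟩
  set r := (InnerProductSpace.toDual ℝ (Y0 A)).symm L
  -- Lax–Milgram places the solution in the first slot; symmetry of the form moves it to the second.
  have hσ : ∀ τ, form ψ χ τ (hc.continuousLinearEquivOfBilin.symm r) = L τ := by
    intro τ
    rw [form_symm, ← formL_apply, ← hc.continuousLinearEquivOfBilin_apply,
      ContinuousLinearEquiv.apply_symm_apply, InnerProductSpace.toDual_symm_apply]
  refine ⟨_, hσ, fun σ' h' => ?_, ?_⟩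
  · rw [ContinuousLinearEquiv.eq_symm_apply]
    refine (hc.unique_continuousLinearEquivOfBilin fun τ => ?_).symm
    rw [InnerProductSpace.toDual_symm_apply, formL_apply, form_symm, h']
  · set σ := hc.continuousLinearEquivOfBilin.symm r
    -- The equation is tested with `τ = σ`.
    have h1 : β * ‖σ‖ ^ 2 ≤ ‖L‖ * ‖σ‖ :=
      (h σ).trans ((hσ σ).trans_le ((le_abs_self _).trans (L.le_opNorm σ)))
    rw [one_div, inv_mul_eq_div, le_div_iff₀ hβ]
    rcases (norm_nonneg σ).eq_or_lt with h0 | h0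
    · rw [← h0, zero_mul]
      exact norm_nonneg L
    · exact le_of_mul_le_mul_right (by linarith) h0

end Tensor

end PlanarStress

theorem mainTheorem2 (A : Set PlanarStress.Plane) (hA : IsOpen A) (hAb : Bornology.IsBounded A) :
    ∃ α β : ℝ → ℝ → ℝ, ∀ ν ψ χ : ℝ, 0 ≤ ν → ν ≤ 1 / 2 → 0 < ψ →
      (χ = 1 / (1 + ν) ∨ χ = 1 - ν) →
      -- continuity and coercivity of the bilinear form
      (∀ τ σ : PlanarStress.Y0 A, |PlanarStress.form ψ χ τ σ| ≤ α ψ χ * ‖τ‖ * ‖σ‖) ∧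
      0 < β ψ χ ∧
      (∀ σ : PlanarStress.Y0 A, β ψ χ * ‖σ‖ ^ 2 ≤ PlanarStress.form ψ χ σ σ) ∧
      -- existence, uniqueness and stability for every right-hand side in the dual space
      (∀ L : StrongDual ℝ (PlanarStress.Y0 A), ∃ σ : PlanarStress.Y0 A,
        (∀ τ, PlanarStress.form ψ χ τ σ = L τ) ∧
        (∀ σ' : PlanarStress.Y0 A, (∀ τ, PlanarStress.form ψ χ τ σ' = L τ) → σ' = σ) ∧
        ‖σ‖ ≤ 1 / β ψ χ * ‖L‖) ∧
      -- the same for the right-hand side given by a body force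
      (∀ f : Fin 2 → PlanarStress.H1 A, ∃ l : StrongDual ℝ (PlanarStress.Y0 A),
        (∀ τ, l τ = PlanarStress.load ψ f τ) ∧
        ∃ σ : PlanarStress.Y0 A,
          (∀ τ, PlanarStress.form ψ χ τ σ = PlanarStress.load ψ f τ) ∧
          (∀ σ' : PlanarStress.Y0 A,
            (∀ τ, PlanarStress.form ψ χ τ σ' = PlanarStress.load ψ f τ) → σ' = σ) ∧
          ‖σ‖ ≤ 1 / β ψ χ * ‖l‖) := by

  obtain ⟨R, hR⟩ := hAb.exists_norm_le
  refine ⟨fun ψ χ => 8 * (ψ + χ), fun ψ χ => 1 / ((1 + 4 * R ^ 2) * (5 * (1 / ψ + 2 / χ))),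
    fun ν ψ χ hν hν' hψ hχ => ?_⟩
  have hχ0 : 0 < χ := by
    rcases hχ with rfl | rfl
    · positivity
    · linarith
  have hK : 0 < (1 + 4 * R ^ 2) * (5 * (1 / ψ + 2 / χ)) := by positivity
  have hβ : 0 < 1 / ((1 + 4 * R ^ 2) * (5 * (1 / ψ + 2 / χ))) := one_div_pos.2 hK
  have hco : ∀ σ : PlanarStress.Y0 A, 1 / ((1 + 4 * R ^ 2) * (5 * (1 / ψ + 2 / χ))) * ‖σ‖ ^ 2 ≤
      PlanarStress.form ψ χ σ σ := fun σ => by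
    rw [one_div, inv_mul_le_iff₀ hK]
    exact PlanarStress.norm_sq_le_form hA hR hψ hχ0 σ
  refine ⟨PlanarStress.abs_form_le hψ.le hχ0.le, hβ, hco,
    PlanarStress.exists_unique_solution hβ hco, fun f =>
      ⟨PlanarStress.loadL ψ f, PlanarStress.loadL_apply ψ f, ?_⟩⟩
  simpa only [PlanarStress.loadL_apply] using
    PlanarStress.exists_unique_solution hβ hco (PlanarStress.loadL ψ f)
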